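/- Let $\Lambda>0$. On a flat slice $\mathbb{R}^3$ consider the vacuum ($\mu=0$, $J=0$) Flatly Foliated Relativity equations in elliptic form for functions $f,\eta:\mathbb{R}^3\to\mathbb{R}$ and a one-form $\zeta=(\zeta_1,\zeta_2,\zeta_3)$, $$(\Delta f)^2-\sum_{i,j}Q_{ij}^2=2\Lambda\,\eta^2,\qquad \Delta\zeta_i=-\frac{2}{\eta}\sum_j(\Delta f\,\delta_{ij}-Q_{ij})\,\partial_j\eta,\qquad \sum_{i,j}(\Delta f\,\delta_{ij}-Q_{ij})\,\partial_i\partial_j\eta=0,$$ where $Q_{ij}=\partial_i\partial_jf+\tfrac12(\partial_j\zeta_i+\partial_i\zeta_j)$. Let $\bar f(x)$ denote the average of $f$ over the sphere of radius $|x|$ centred at the origin, and call $f$ approximately spherically symmetric at infinity if $f-\bar f$ is bounded and $$\lim_{r\to\infty}\ \sup_{|x|=r} r^2\,\bigl\|\nabla^2(f-\bar f)\,\nabla(f-\bar f)\bigr\|=0,$$ where $\nabla^2(f-\bar f)\,\nabla(f-\bar f)$ is the Hessian applied to the gradient. Consider the $C^\infty$ solutions $(f,\zeta,\eta)$ on $\mathbb{R}^3$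 with $\eta>0$ and $\Delta f/\eta>0$ (the arrow of time convention: positive mean curvature of the slice), such that $f$ is approximately spherically symmetric at infinity, and $\zeta(x)\to0$ and $\eta(x)\to1$ as $|x|\to\infty$. Then such a solution exists and is unique up to an additive constant in $f$: for every $c\in\mathbb{R}$ the triple $$f=\sqrt{\Lambda/12}\;|x|^2+c,\qquad \zeta\equiv0,\qquad \eta\equiv1$$ is such a solution (and satisfies $\nabla\cdot\zeta\to0$ at infinity), and every such solution is of this form for some $c\in\mathbb{R}$. -/

import Mathlib

open MeasureTheory Filter Topology
open scoped ContDiff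

noncomputable section

namespace FFR

/-- Euclidean three-space, a flat slice `{t = const}`. -/
abbrev E3 : Type := EuclideanSpace ℝ (Fin 3)

/-- The partial derivative `∂u/∂xᵢ`. -/
def pd (i : Fin 3) (u : E3 → ℝ) (x : E3) : ℝ :=
  fderiv ℝ u x (EuclideanSpace.single i 1)

/-- The Laplacian `Δu` of the flat metric. -/
def lap (u : E3 → ℝ) (x : E3) : ℝ := Laplacian.laplacian u x

/-- The divergence `V_{i,i}`. -/
def divergence (V : E3 → E3) (x : E3) : ℝ :=
  ∑ i, pd i (fun y => V y i) x

/-- The Hessian `u_{ij} = ∂ⱼ ∂ᵢ u`. -/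
def hess (u : E3 → ℝ) (i j : Fin 3) (x : E3) : ℝ := pd j (pd i u) x

/-- `Q_{ij} = f_{ij} + ½ (ζ_{i,j} + ζ_{j,i})`, where `ζ_{i,j} = ∂ⱼ ζᵢ`.
The one-form `ζ` is given by its vector of components. -/
def Q (f : E3 → ℝ) (ζ : E3 → E3) (i j : Fin 3) (x : E3) : ℝ :=
  hess f i j x + (1 / 2) * (pd j (fun y => ζ y i) x + pd i (fun y => ζ y j) x)

/-- The coefficients `Δf δ_{ij} - Q_{ij}`. -/
def coeff (f : E3 → ℝ) (ζ : E3 → E3) (i j : Fin 3) (x : E3) : ℝ :=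
  lap f x * (if i = j then 1 else 0) - Q f ζ i j x

/-- `(f, ζ, η)` is a smooth solution with `η > 0`, on a flat slice, of the Flatly Foliated Relativity
equations in elliptic form, for the cosmological constant `Λ`, the energy density `μ` and the
momentum density `J`. The normalization `∇ · ζ → 0` at infinity which goes with these equations
is stated separately. -/
structure IsSolution (Λ : ℝ) (μ : E3 → ℝ) (J : E3 → E3)
    (f : E3 → ℝ) (ζ : E3 → E3) (η : E3 → ℝ) : Prop where
  smooth_f : ContDiff ℝ ∞ f
  smooth_zeta : ContDiff ℝ ∞ ζ
  smooth_eta : ContDiff ℝ ∞ η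
  eta_pos : ∀ x, 0 < η x
  eq_f : ∀ x, (lap f x) ^ 2 - ∑ i, ∑ j, (Q f ζ i j x) ^ 2
    = (16 * Real.pi * μ x + 2 * Λ) * (η x) ^ 2
  eq_zeta : ∀ x, ∀ i, lap (fun y => ζ y i) x
    = 16 * Real.pi * J x i * η x - (2 / η x) * ∑ j, coeff f ζ i j x * pd j η x
  eq_eta : ∀ x, ∑ i, ∑ j, coeff f ζ i j x * hess η i j x
    = 8 * Real.pi * divergence (fun y => (η y) ^ 2 • J y) x

/-- The arrow of time convention: the mean curvature `Δf / η` of the slice is positive. -/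
def ArrowOfTime (f η : E3 → ℝ) : Prop := ∀ x, 0 < lap f x / η x

/-- The spherical symmetrization of `u`: the average of `u` over the sphere of radius `‖x‖` around
the origin, with respect to the surface measure of the unit sphere. -/
def sphAvg (u : E3 → ℝ) (x : E3) : ℝ :=
  ⨍ σ : Metric.sphere (0 : E3) 1, u (‖x‖ • (σ : E3)) ∂((volume : Measure E3).toSphere)

/-- Approximate spherical symmetry at infinity: `g = f - f̄` is bounded, and the supremum over
`x ∈ S_r` of `r² ‖∇²g ∇g‖` tends to `0` as `r → ∞`. Here `∇²g ∇g` is the Hessian of `g` applied to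
the gradient of `g`. -/
def ApproxSphericallySymmetric (f : E3 → ℝ) : Prop :=
  (∃ C : ℝ, ∀ x, |f x - sphAvg f x| ≤ C) ∧
  ∀ ε > 0, ∃ r₀ : ℝ, ∀ r ≥ r₀, ∀ x ∈ Metric.sphere (0 : E3) r,
    r ^ 2 * ‖fderiv ℝ (gradient (f - sphAvg f)) x (gradient (f - sphAvg f) x)‖ ≤ ε

/-- `(f, ζ, η)` is a smooth vacuum solution on a flat slice (`μ = 0`, `J = 0`), with the arrow of time
convention, `f` approximately spherically symmetric at infinity, and `ζ → 0`, `η → 1`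
at infinity. -/
structure IsAdmissibleVacuum (Λ : ℝ) (f : E3 → ℝ) (ζ : E3 → E3) (η : E3 → ℝ) : Prop where
  solution : IsSolution Λ 0 0 f ζ η
  arrow : ArrowOfTime f η
  approx_symm : ApproxSphericallySymmetric f
  zeta_lim : Tendsto ζ (cocompact E3) (𝓝 0)
  eta_lim : Tendsto η (cocompact E3) (𝓝 1)

end FFR

end

/-! Since `Λ > 0`, the first equation gives `|Q| < Δf`, so `Δf δ - Q` is positive definite and the
equation for `η` is elliptic without zeroth-order term. The maximum principle and `η → 1` force `η =
1`; each `ζᵢ` is then harmonic and tends to `0`, so `ζ = 0` (`eq_of_elliptic_of_tendsto`).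

What remains is `(Δf)² - |D²f|² = 2Λ`. Write `Λ = 12a²` and `u = f - a|x|²`. Then `(Δu)² - |D²u|² =
-8a Δu`, and `|D²f|² ≥ (Δf)²/3` gives `Δf ≥ 6a`, that is `Δu ≥ 0`. The left side is a double
divergence, so its integral against a test function `φ` involves only `D²φ` and products of first
derivatives of `u` (`integral_sigma_two`). For `φ` radial and decreasing in `|x|`, the part with
`|∇u|²` has a favourable sign and only `|x × ∇u|²` must be controlled; sublinear growth of it forces
`Δu = 0` (`sum_hess_eq_zero_of_crossSq_le`).

Approximate symmetry supplies this growth. Radial functions do not contribute to `x × ∇`, so `u` may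
be replaced by `g = f - f̄`. As `g` is bounded, some point within `|x|/2` of `x` has gradient
`O(1/|x|)`; as `∇|∇g|² = 2 ∇²g ∇g = o(|x|⁻²)`, this propagates to `|∇g|² = O(|x|⁻²) + o(|x|⁻¹)` at
`x`.

Finally `Δu = 0` gives `D²u = 0`, so `u` is affine, and boundedness of `f - f̄` removes the linear
part. -/

noncomputable section

namespace FFR

/-! ### Coordinate calculus for partial derivatives and Hessians -/

section Calculus

theorem two_le_infty : (2 : WithTop ℕ∞) ≤ ∞ :=
  WithTop.coe_le_coe.2 (le_top : (2 : ℕ∞) ≤ ⊤)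

variable {u v : E3 → ℝ}

theorem contDiff_pd (hu : ContDiff ℝ ∞ u) (i : Fin 3) : ContDiff ℝ ∞ (pd i u) :=
  (hu.fderiv_right (m := ∞) (by simp)).clm_apply contDiff_const

theorem contDiff_hess (hu : ContDiff ℝ ∞ u) (i j : Fin 3) : ContDiff ℝ ∞ (hess u i j) :=
  contDiff_pd (contDiff_pd hu i) j

theorem contDiff_differentiable (hu : ContDiff ℝ ∞ u) : Differentiable ℝ u :=
  hu.differentiable (by simp)

theorem pd_add (hu : Differentiable ℝ u) (hv : Differentiable ℝ v) (i : Fin 3) (x : E3) :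
    pd i (fun y => u y + v y) x = pd i u x + pd i v x := by
  simp [pd, fderiv_fun_add (hu x) (hv x)]

theorem pd_sub (hu : Differentiable ℝ u) (hv : Differentiable ℝ v) (i : Fin 3) (x : E3) :
    pd i (fun y => u y - v y) x = pd i u x - pd i v x := by
  simp [pd, fderiv_fun_sub (hu x) (hv x)]

theorem pd_mul (hu : Differentiable ℝ u) (hv : Differentiable ℝ v) (i : Fin 3) (x : E3) :
    pd i (fun y => u y * v y) x = pd i u x * v x + u x * pd i v x := by
  simp [pd, fderiv_fun_mul (hu x) (hv x)]; ring

theorem pd_const_mul (hu : Differentiable ℝ u) (a : ℝ) (i : Fin 3) (x : E3) :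
    pd i (fun y => a * u y) x = a * pd i u x := by
  simp [pd, fderiv_const_mul (hu x)]

@[simp]
theorem pd_const (a : ℝ) (i : Fin 3) (x : E3) : pd i (fun _ => a) x = 0 := by
  simp [pd]

theorem pd_coord (i j : Fin 3) (x : E3) : pd i (fun y => y j) x = if i = j then 1 else 0 := by
  have : (fun y : E3 => y j) = EuclideanSpace.proj (𝕜 := ℝ) j := by ext; simp
  rw [pd, this, ContinuousLinearMap.fderiv]
  simp [eq_comm]

theorem differentiable_coord (j : Fin 3) : Differentiable ℝ (fun y : E3 => y j) :=
  (EuclideanSpace.proj (𝕜 := ℝ) j : E3 →L[ℝ] ℝ).differentiable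

theorem pd_comp {χ : ℝ → ℝ} (hχ : Differentiable ℝ χ) (hu : Differentiable ℝ u) (i : Fin 3)
    (x : E3) : pd i (fun y => χ (u y)) x = deriv χ (u x) * pd i u x := by
  have h := ((hχ (u x)).hasDerivAt.comp_hasFDerivAt x (hu x).hasFDerivAt).fderiv
  have h' : fderiv ℝ (fun y => χ (u y)) x = _ := h
  simp [pd, h']

theorem pd_norm_sq (i : Fin 3) (x : E3) : pd i (fun y => ‖y‖ ^ 2) x = 2 * x i := by
  have : (fun y : E3 => ‖y‖ ^ 2) = fun y => ∑ j, y j * y j := by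
    ext y; simp only [EuclideanSpace.norm_sq_eq, Real.norm_eq_abs, sq_abs, ← sq]
  rw [this]
  have h : (fun y : E3 => ∑ j, y j * y j) = fun y => (y 0 * y 0 + y 1 * y 1) + y 2 * y 2 := by
    ext y; simp [Fin.sum_univ_three]
  have d := fun j => (differentiable_coord j).fun_mul (differentiable_coord j)
  rw [h, pd_add ((d 0).fun_add (d 1)) (d 2), pd_add (d 0) (d 1)]
  simp only [pd_mul (differentiable_coord _) (differentiable_coord _), pd_coord]
  fin_cases i <;> simp <;> ring

theorem fderiv_apply_eq_sum_pd (u : E3 → ℝ) (x ξ : E3) :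
    fderiv ℝ u x ξ = ∑ i, ξ i * pd i u x := by
  have : ξ = ∑ i, ξ i • EuclideanSpace.single i (1 : ℝ) := by
    ext j; simp [Finset.sum_apply, Pi.single_apply]
  conv_lhs => rw [this]
  simp [pd]

theorem hess_eq_fderiv_fderiv (hu : ContDiff ℝ ∞ u) (i j : Fin 3) (x : E3) :
    hess u i j x = fderiv ℝ (fderiv ℝ u) x (EuclideanSpace.single j 1)
      (EuclideanSpace.single i 1) := by
  have h : DifferentiableAt ℝ (fderiv ℝ u) x :=
    (hu.fderiv_right (m := ∞) (by simp)).differentiable (by simp) x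
  rw [hess, pd]
  have : pd i u = fun y => fderiv ℝ u y (EuclideanSpace.single i 1) := rfl
  rw [this, fderiv_clm_apply h (differentiableAt_const _)]
  simp

theorem hess_comm (hu : ContDiff ℝ ∞ u) (i j : Fin 3) (x : E3) :
    hess u i j x = hess u j i x := by
  rw [hess_eq_fderiv_fderiv hu, hess_eq_fderiv_fderiv hu]
  exact hu.contDiffAt.isSymmSndFDerivAt (by simpa using two_le_infty) _ _

theorem lap_eq_sum_hess (hu : ContDiff ℝ ∞ u) (x : E3) : lap u x = ∑ i, hess u i i x := by
  rw [lap, InnerProductSpace.laplacian_eq_iteratedFDeriv_orthonormalBasis u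
    (EuclideanSpace.basisFun (Fin 3) ℝ)]
  simp [iteratedFDeriv_two_apply, hess_eq_fderiv_fderiv hu]

theorem deriv_line (hu : Differentiable ℝ u) (x ξ : E3) (t : ℝ) :
    HasDerivAt (fun s : ℝ => u (x + s • ξ)) (∑ i, ξ i * pd i u (x + t • ξ)) t := by
  rw [← fderiv_apply_eq_sum_pd]
  have h : HasDerivAt (fun s : ℝ => x + s • ξ) ξ t := by
    simpa using ((hasDerivAt_id t).smul_const ξ).const_add x
  exact (hu _).hasFDerivAt.comp_hasDerivAt t h

end Calculus

/-! ### Maximum principle on the whole space -/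

section MaximumPrinciple

/-- Otherwise the second derivative test makes `t` a local minimum as well, so `w` is constant near
`t` and its second derivative vanishes. -/
theorem deriv_deriv_nonpos_of_isLocalMax {w : ℝ → ℝ} {t : ℝ} (hw : ContDiff ℝ 2 w)
    (h : IsLocalMax w t) : deriv (deriv w) t ≤ 0 := by
  by_contra! hpos
  have h0 : deriv w t = 0 := h.deriv_eq_zero
  have hmin := isLocalMin_of_deriv_deriv_pos hpos h0 hw.continuous.continuousAt
  have hc : w =ᶠ[𝓝 t] fun _ => w t := by
    filter_upwards [h, hmin] with s h1 h2 using le_antisymm h1 h2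
  have := hc.deriv.deriv_eq
  simp [this] at hpos

theorem hess_nonpos_of_isLocalMax {w : E3 → ℝ} (hw : ContDiff ℝ ∞ w) {x : E3}
    (h : IsLocalMax w x) (ξ : E3) : ∑ i, ∑ j, ξ i * ξ j * hess w i j x ≤ 0 := by
  have hline : ContDiff ℝ 2 (fun s : ℝ => w (x + s • ξ)) :=
    (hw.of_le two_le_infty).comp
      (contDiff_const.add (contDiff_id.smul contDiff_const))
  have hmax : IsLocalMax (fun s : ℝ => w (x + s • ξ)) 0 := by
    have hc : ContinuousAt (fun s : ℝ => x + s • ξ) 0 := by fun_prop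
    have hx : (fun s : ℝ => x + s • ξ) 0 = x := by simp
    have h' : IsLocalMax w ((fun s : ℝ => x + s • ξ) 0) := by rwa [hx]
    exact IsMaxFilter.comp_tendsto (g := fun s : ℝ => x + s • ξ) h' hc
  have key := deriv_deriv_nonpos_of_isLocalMax hline hmax
  have d1 : deriv (fun s : ℝ => w (x + s • ξ)) = fun t => ∑ i, ξ i * pd i w (x + t • ξ) :=
    funext fun t => (deriv_line (contDiff_differentiable hw) x ξ t).deriv
  have d2 : HasDerivAt (fun t : ℝ => ∑ i, ξ i * pd i w (x + t • ξ))
      (∑ i, ξ i * ∑ j, ξ j * pd j (pd i w) (x + (0 : ℝ) • ξ)) 0 :=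
    HasDerivAt.fun_sum fun i _ =>
      (deriv_line (contDiff_differentiable (contDiff_pd hw i)) x ξ 0).const_mul (ξ i)
  rw [d1, d2.deriv] at key
  simpa [Finset.mul_sum, mul_assoc, hess] using key

/-- For a negative semidefinite symmetric `W` and `|q| ≤ T`, the pairing of `T δ - q` with `W` is
nonpositive. -/
theorem pairing_nonpos {W q : Fin 3 → Fin 3 → ℝ} {T : ℝ} (hT : 0 ≤ T)
    (hW : ∀ i j, W i j = W j i)
    (hneg : ∀ ξ : E3, ∑ i, ∑ j, ξ i * ξ j * W i j ≤ 0)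
    (hq : ∑ i, ∑ j, q i j ^ 2 ≤ T ^ 2) :
    ∑ i, ∑ j, (T * (if i = j then 1 else 0) - q i j) * W i j ≤ 0 := by
  have hdiag : ∀ i, W i i ≤ 0 := by
    intro i
    have := hneg (EuclideanSpace.single i 1)
    simpa [Pi.single_apply] using this
  have hminor : ∀ i j, i ≠ j → W i j ^ 2 ≤ W i i * W j j := by
    intro i j hij
    -- The form `-W` at `eᵢ + t eⱼ` is a nonnegative quadratic in `t`; its discriminant gives the
    -- 2×2 minor.
    have h1 : ∀ t : ℝ, 0 ≤ -W j j * (t * t) + -(2 * W i j) * t + -W i i := by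
      intro t
      have := hneg (EuclideanSpace.single i 1 + t • EuclideanSpace.single j 1)
      have hs := hW j i
      simp only [PiLp.add_apply, PiLp.smul_apply, PiLp.single_apply, smul_eq_mul,
        Fin.sum_univ_three] at this
      fin_cases i <;> fin_cases j <;> simp at this hs hij ⊢ <;>
        (rw [hs] at this; linarith)
    have h2 := discrim_le_zero h1
    rw [discrim] at h2
    nlinarith
  -- Nonnegative principal 2×2 minors say that `|W|² ≤ (tr W)²`. With Cauchy–Schwarz this gives
  -- `|⟨q, W⟩| ≤ T |tr W|`, without diagonalizing.
  have hWW : ∑ i, ∑ j, W i j ^ 2 ≤ (-∑ i, W i i) ^ 2 := by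
    have a := hminor 0 1 (by decide)
    have b := hminor 0 2 (by decide)
    have c := hminor 1 2 (by decide)
    simp only [Fin.sum_univ_three, hW 1 0, hW 2 0, hW 2 1]
    nlinarith
  have htr : 0 ≤ -∑ i, W i i := by
    have := Finset.sum_nonpos fun i (_ : i ∈ Finset.univ) => hdiag i
    linarith
  have hcs : (∑ i, ∑ j, q i j * W i j) ^ 2 ≤ (∑ i, ∑ j, q i j ^ 2) * ∑ i, ∑ j, W i j ^ 2 := by
    have := Finset.sum_mul_sq_le_sq_mul_sq (Finset.univ : Finset (Fin 3 × Fin 3))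
      (fun p => q p.1 p.2) (fun p => W p.1 p.2)
    simpa [Fintype.sum_prod_type] using this
  have hab : (∑ i, ∑ j, q i j * W i j) ^ 2 ≤ (T * -∑ i, W i i) ^ 2 := by
    rw [mul_pow]
    exact hcs.trans (mul_le_mul hq hWW (by positivity) (by positivity))
  have := neg_le_of_abs_le (abs_le_of_sq_le_sq hab (mul_nonneg hT htr))
  have e : ∑ i, ∑ j, (T * (if i = j then 1 else 0) - q i j) * W i j
      = T * ∑ i, W i i - ∑ i, ∑ j, q i j * W i j := by
    simp [sub_mul, Finset.sum_sub_distrib, Finset.mul_sum]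
  rw [e]; linarith

theorem contDiff_norm_sq_E3 : ContDiff ℝ ∞ (fun y : E3 => ‖y‖ ^ 2) := contDiff_norm_sq ℝ

theorem pd_add_const_mul_norm_sq {u : E3 → ℝ} (hu : Differentiable ℝ u) (ε : ℝ) (i : Fin 3)
    (x : E3) : pd i (fun y => u y + ε * ‖y‖ ^ 2) x = pd i u x + 2 * ε * x i := by
  have h := contDiff_differentiable contDiff_norm_sq_E3
  rw [pd_add hu (h.const_mul ε), pd_const_mul h, pd_norm_sq]
  ring

theorem hess_add_const_mul_norm_sq {u : E3 → ℝ} (hu : ContDiff ℝ ∞ u) (ε : ℝ) (i j : Fin 3)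
    (x : E3) : hess (fun y => u y + ε * ‖y‖ ^ 2) i j x
      = hess u i j x + ε * if i = j then 2 else 0 := by
  have h : pd i (fun y => u y + ε * ‖y‖ ^ 2) = fun y => pd i u y + 2 * ε * y i :=
    funext fun y => pd_add_const_mul_norm_sq (contDiff_differentiable hu) ε i y
  rw [hess, h, pd_add (contDiff_differentiable (contDiff_pd hu i))
    ((differentiable_coord i).const_mul _), pd_const_mul (differentiable_coord i), pd_coord]
  by_cases hij : i = j <;> simp [hess, hij, eq_comm]
  ring

/-- If `u` exceeds `c` somewhere, `u + ε|y|²` has an interior maximum on a large ball for small `ε`.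
There the operator is nonpositive on it, yet it equals `2ε tr(T δ - q) > 0`. -/
theorem le_of_elliptic_of_tendsto {u : E3 → ℝ} (hu : ContDiff ℝ ∞ u)
    {T : E3 → ℝ} {q : Fin 3 → Fin 3 → E3 → ℝ} (hT : ∀ x, 0 < T x)
    (hq : ∀ x, ∑ i, ∑ j, q i j x ^ 2 ≤ T x ^ 2)
    (heq : ∀ x, ∑ i, ∑ j, (T x * (if i = j then 1 else 0) - q i j x) * hess u i j x = 0)
    {c : ℝ} (hlim : Tendsto u (cocompact E3) (𝓝 c)) (x : E3) : u x ≤ c := by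
  by_contra! hx
  set δ := (u x - c) / 2 with hδ
  have hδ0 : 0 < δ := by linarith
  have hev : ∀ᶠ y in cocompact E3, u y < c + δ :=
    hlim.eventually (gt_mem_nhds (by linarith))
  obtain ⟨R, hR⟩ : ∃ R : ℝ, ∀ y : E3, R < ‖y‖ → u y < c + δ := by
    rw [← Metric.cobounded_eq_cocompact, ← comap_norm_atTop] at hev
    obtain ⟨R, -, hR⟩ := ((atTop_basis_Ioi (α := ℝ)).comap _).eventually_iff.1 hev
    exact ⟨R, fun y hy => hR hy⟩
  set S := max (R + 1) (‖x‖ + 1) with hS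
  have hS1 : R < S := by have := le_max_left (R + 1) (‖x‖ + 1); linarith
  have hS2 : ‖x‖ < S := by have := le_max_right (R + 1) (‖x‖ + 1); linarith
  have hS0 : 0 < S := (norm_nonneg x).trans_lt hS2
  -- With this `ε` the perturbation equals `δ` on the sphere of radius `S`, where `u < c + δ`. So `w
  -- < c + 2δ = u x ≤ w x` there, and the maximum is interior.
  set ε := δ / S ^ 2 with hε
  have hε0 : 0 < ε := by positivity
  set w : E3 → ℝ := fun y => u y + ε * ‖y‖ ^ 2 with hw
  have hwc : ContDiff ℝ ∞ w := hu.add (contDiff_const.mul contDiff_norm_sq_E3)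
  obtain ⟨y, hy, hmax⟩ := (isCompact_closedBall (0 : E3) S).exists_isMaxOn
    ⟨x, by simpa using hS2.le⟩ hwc.continuous.continuousOn
  have hxy : w x ≤ w y := hmax (by simpa using hS2.le)
  have hyS : ‖y‖ ≤ S := by simpa using hy
  have hin : ‖y‖ < S := by
    by_contra! hge
    have h1 := hR y (hS1.trans_le hge)
    have h2 : ε * ‖y‖ ^ 2 ≤ δ := by
      rw [le_antisymm hyS hge, hε]; field_simp; rfl
    have h3 : u x ≤ w x := by simp only [hw]; nlinarith [sq_nonneg ‖x‖]
    simp only [hw] at hxy h3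
    linarith
  have hloc : IsLocalMax w y := hmax.isLocalMax (by
    rw [mem_nhds_iff]
    exact ⟨Metric.ball 0 S, Metric.ball_subset_closedBall, Metric.isOpen_ball, by simpa using hin⟩)
  have key := pairing_nonpos (hT y).le (fun i j => hess_comm hwc i j y)
    (hess_nonpos_of_isLocalMax hwc hloc) (hq y)
  -- The bound `|q| ≤ T` yields `tr q ≤ √3 T < 3T`, which is the strictness needed.
  have htr : (∑ i, q i i y) ^ 2 ≤ 3 * T y ^ 2 := by
    have h := hq y
    simp only [Fin.sum_univ_three] at h ⊢
    nlinarith [sq_nonneg (q 0 0 y - q 1 1 y), sq_nonneg (q 0 0 y - q 2 2 y),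
      sq_nonneg (q 1 1 y - q 2 2 y), sq_nonneg (q 0 1 y), sq_nonneg (q 0 2 y),
      sq_nonneg (q 1 0 y), sq_nonneg (q 1 2 y), sq_nonneg (q 2 0 y), sq_nonneg (q 2 1 y)]
  have htr' : ∑ i, q i i y < 3 * T y := by
    have := hT y
    apply lt_of_pow_lt_pow_left₀ 2 (by positivity)
    nlinarith [sq_pos_of_pos this]
  have e : ∑ i, ∑ j, (T y * (if i = j then 1 else 0) - q i j y) * hess w i j y
      = 2 * ε * (3 * T y - ∑ i, q i i y) := by
    have := heq y
    simp only [hw, hess_add_const_mul_norm_sq hu, mul_add, Finset.sum_add_distrib, this]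
    simp [Fin.sum_univ_three]
    ring
  rw [e] at key
  nlinarith

theorem eq_of_elliptic_of_tendsto {u : E3 → ℝ} (hu : ContDiff ℝ ∞ u)
    {T : E3 → ℝ} {q : Fin 3 → Fin 3 → E3 → ℝ} (hT : ∀ x, 0 < T x)
    (hq : ∀ x, ∑ i, ∑ j, q i j x ^ 2 ≤ T x ^ 2)
    (heq : ∀ x, ∑ i, ∑ j, (T x * (if i = j then 1 else 0) - q i j x) * hess u i j x = 0)
    {c : ℝ} (hlim : Tendsto u (cocompact E3) (𝓝 c)) (x : E3) : u x = c := by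
  refine le_antisymm (le_of_elliptic_of_tendsto hu hT hq heq hlim x) ?_
  have hn : ∀ i j y, hess (fun z => -u z) i j y = -hess u i j y := by
    intro i j y
    have h : (fun z => -u z) = fun z => (-1 : ℝ) * u z := by ext; simp
    have h1 : pd i (fun z => (-1 : ℝ) * u z) = fun z => (-1 : ℝ) * pd i u z :=
      funext fun z => pd_const_mul (contDiff_differentiable hu) _ i z
    rw [h, hess, h1, pd_const_mul (contDiff_differentiable (contDiff_pd hu i))]
    simp [hess]
  have := le_of_elliptic_of_tendsto (u := fun z => -u z) hu.neg hT hq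
    (fun y => by simp only [hn, mul_neg, Finset.sum_neg_distrib, heq y, neg_zero]) hlim.neg x
  linarith

end MaximumPrinciple

/-! ### Double integration by parts for `σ₂` -/

section IntegralIdentity

theorem hasCompactSupport_pd {w : E3 → ℝ} (hw : HasCompactSupport w) (i : Fin 3) :
    HasCompactSupport (pd i w) :=
  hw.fderiv_apply ℝ _

theorem integral_pd_eq_zero {w : E3 → ℝ} (hw : ContDiff ℝ ∞ w) (hc : HasCompactSupport w)
    (i : Fin 3) : ∫ x, pd i w x = 0 := by
  have hint : Integrable fun x => fderiv ℝ w x (EuclideanSpace.single i 1) :=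
    (contDiff_pd hw i).continuous.integrable_of_hasCompactSupport (hasCompactSupport_pd hc i)
  have hint' : Integrable w := hw.continuous.integrable_of_hasCompactSupport hc
  have := integral_mul_fderiv_eq_neg_fderiv_mul_of_integrable (μ := (volume : Measure E3))
    (f := fun _ => (1 : ℝ)) (g := w) (v := EuclideanSpace.single i 1) (by simp)
    (by simpa using hint)
    (by simpa using hint') (fun x _ => by fun_prop)
    (fun x _ => contDiff_differentiable hw x)
  simpa [pd] using this

/-- Brings third derivatives to a common form, so that they cancel in the sum defining the
divergence. -/
theorem pd_hess_diag {h : E3 → ℝ} (hh : ContDiff ℝ ∞ h) (i j : Fin 3) (x : E3) :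
    pd i (hess h j j) x = pd j (hess h i j) x := by
  have h1 : hess h i j = hess h j i := funext fun y => hess_comm hh i j y
  rw [h1]
  exact hess_comm (contDiff_pd hh j) j i x

/-- Integrating `σ₂(D²h) = (Δh)² - |D²h|²` twice by parts against a test function. -/
theorem integral_sigma_two {h φ : E3 → ℝ} (hh : ContDiff ℝ ∞ h) (hφ : ContDiff ℝ ∞ φ)
    (hc : HasCompactSupport φ) :
    ∫ x, φ x * ((∑ i, hess h i i x) ^ 2 - ∑ i, ∑ j, hess h i j x ^ 2)
      = ∫ x, ∑ i, ∑ j, (hess φ i j x * (pd i h x * pd j h x) - hess φ i i x * pd j h x ^ 2) := by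
  have h0 := contDiff_differentiable hφ
  have h1 := fun i => contDiff_pd hφ i
  have h1' := fun i => contDiff_differentiable (h1 i)
  have h2 := fun i => contDiff_pd hh i
  have h2' := fun i => contDiff_differentiable (h2 i)
  have h3 := fun i j => contDiff_hess hh i j
  have h3' := fun i j => contDiff_differentiable (h3 i j)
  have h4 := fun i j => contDiff_hess hφ i j
  -- Both integrations by parts in one divergence: the first line writes `σ₂` as the divergence of
  -- `Δh ∇h - D²h ∇h`, and the second moves the remaining second derivatives of `h` onto `φ`.
  set V : Fin 3 → Fin 3 → E3 → ℝ := fun i j y =>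
    φ y * (pd i h y * hess h j j y - pd j h y * hess h i j y)
      - (pd j φ y * (pd i h y * pd j h y) - pd i φ y * (pd j h y * pd j h y)) with hV
  have hVs : ∀ i j, ContDiff ℝ ∞ (V i j) := fun i j =>
    (hφ.mul (((h2 i).mul (h3 j j)).sub ((h2 j).mul (h3 i j)))).sub
      (((h1 j).mul ((h2 i).mul (h2 j))).sub ((h1 i).mul ((h2 j).mul (h2 j))))
  have hVc : ∀ i j, HasCompactSupport (V i j) := fun i j =>
    (hc.mul_right).sub
      (((hasCompactSupport_pd hc j).mul_right).sub ((hasCompactSupport_pd hc i).mul_right))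
  have hVi : ∀ i j, Integrable (pd i (V i j)) := fun i j =>
    (contDiff_pd (hVs i j) i).continuous.integrable_of_hasCompactSupport
      (hasCompactSupport_pd (hVc i j) i)
  have hpd : ∀ i j x, pd i (V i j) x =
      pd i φ x * (pd i h x * hess h j j x - pd j h x * hess h i j x)
      + φ x * (hess h i i x * hess h j j x + pd i h x * pd i (hess h j j) x
        - (hess h j i x * hess h i j x + pd j h x * pd i (hess h i j) x))
      - (hess φ j i x * (pd i h x * pd j h x)
          + pd j φ x * (hess h i i x * pd j h x + pd i h x * hess h j i x)
        - (hess φ i i x * (pd j h x * pd j h x)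
          + pd i φ x * (hess h j i x * pd j h x + pd j h x * hess h j i x))) := by
    intro i j x
    have d1 := (h2' i).fun_mul (h3' j j)
    have d2 := (h2' j).fun_mul (h3' i j)
    have d3 := (h2' i).fun_mul (h2' j)
    have d4 := (h2' j).fun_mul (h2' j)
    rw [hV]
    simp only
    rw [pd_sub (h0.fun_mul (d1.fun_sub d2)) (((h1' j).fun_mul d3).fun_sub ((h1' i).fun_mul d4)),
      pd_mul h0 (d1.fun_sub d2), pd_sub d1 d2, pd_sub ((h1' j).fun_mul d3) ((h1' i).fun_mul d4),
      pd_mul (h2' i) (h3' j j), pd_mul (h2' j) (h3' i j), pd_mul (h1' j) d3, pd_mul (h1' i) d4,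
      pd_mul (h2' i) (h2' j), pd_mul (h2' j) (h2' j)]
    rfl
  have hzero : ∫ x, ∑ i, ∑ j, pd i (V i j) x = 0 := by
    rw [integral_finsetSum _ fun i _ => integrable_finsetSum _ fun j _ => hVi i j]
    refine Finset.sum_eq_zero fun i _ => ?_
    rw [integral_finsetSum _ fun j _ => hVi i j]
    exact Finset.sum_eq_zero fun j _ => integral_pd_eq_zero (hVs i j) (hVc i j) i
  -- This holds only after summing over `i` and `j`: terms cancel between `(i, j)` and `(j, i)`.
  have hpt : ∀ x, φ x * ((∑ i, hess h i i x) ^ 2 - ∑ i, ∑ j, hess h i j x ^ 2)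
      = (∑ i, ∑ j, (hess φ i j x * (pd i h x * pd j h x) - hess φ i i x * pd j h x ^ 2))
        + ∑ i, ∑ j, pd i (V i j) x := by
    intro x
    have a : ∀ i j, hess h i j = hess h j i := fun i j => funext (hess_comm hh i j)
    have b : ∀ i j, hess φ i j x = hess φ j i x := fun i j => hess_comm hφ i j x
    simp only [hpd, Fin.sum_univ_three, a 1 0, a 2 0, a 2 1, b 1 0, b 2 0, b 2 1,
      pd_hess_diag hh 0 1, pd_hess_diag hh 0 2, pd_hess_diag hh 1 0, pd_hess_diag hh 1 2,
      pd_hess_diag hh 2 0, pd_hess_diag hh 2 1]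
    ring
  have hi2 : Integrable fun x => ∑ i, ∑ j, pd i (V i j) x :=
    integrable_finsetSum _ fun i _ => integrable_finsetSum _ fun j _ => hVi i j
  have hi1 : Integrable fun x => ∑ i, ∑ j,
      (hess φ i j x * (pd i h x * pd j h x) - hess φ i i x * pd j h x ^ 2) := by
    refine integrable_finsetSum _ fun i _ => integrable_finsetSum _ fun j _ => ?_
    have hc' := fun i j => hasCompactSupport_pd (hasCompactSupport_pd hc i) j
    refine Continuous.integrable_of_hasCompactSupport ?_ ?_
    · exact ((h4 i j).mul ((h2 i).mul (h2 j))).continuous.sub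
        ((h4 i i).mul ((h2 j).pow 2)).continuous
    · exact (HasCompactSupport.mul_right (hc' i j)).sub (HasCompactSupport.mul_right (hc' i i))
  simp_rw [hpt]
  rw [integral_add hi1 hi2, hzero, add_zero]

end IntegralIdentity

/-! ### Radial cutoff functions -/

section Cutoff

/-- A smooth nonincreasing function on the line, `1` on `(-∞, 1]` and `0` on `[2, ∞)`. -/
def cutoff (s : ℝ) : ℝ := Real.smoothTransition (2 - s)

theorem contDiff_cutoff : ContDiff ℝ ∞ cutoff :=
  Real.smoothTransition.contDiff.comp (contDiff_const.sub contDiff_id)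

theorem antitone_cutoff : Antitone cutoff := fun _ _ h =>
  Real.smoothTransition.monotone (by linarith)

theorem cutoff_nonneg (s : ℝ) : 0 ≤ cutoff s := Real.smoothTransition.nonneg _

theorem cutoff_eq_one {s : ℝ} (hs : s ≤ 1) : cutoff s = 1 :=
  Real.smoothTransition.one_of_one_le (by linarith)

theorem cutoff_eq_zero {s : ℝ} (hs : 2 ≤ s) : cutoff s = 0 :=
  Real.smoothTransition.zero_of_nonpos (by linarith)

theorem deriv_cutoff_nonpos (s : ℝ) : deriv cutoff s ≤ 0 := antitone_cutoff.deriv_nonpos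

theorem contDiff_deriv_cutoff : ContDiff ℝ ∞ (deriv cutoff) :=
  (contDiff_infty_iff_deriv.1 contDiff_cutoff).2

theorem deriv_deriv_cutoff_eq_zero {s : ℝ} (hs : 2 < s) : deriv (deriv cutoff) s = 0 := by
  have h : cutoff =ᶠ[𝓝 s] fun _ => 0 := by
    filter_upwards [lt_mem_nhds hs] with t ht using cutoff_eq_zero ht.le
  have := h.deriv.deriv_eq
  simpa using this

theorem exists_deriv_deriv_cutoff_le :
    ∃ M : ℝ, 0 ≤ M ∧ ∀ s, 0 ≤ s → |deriv (deriv cutoff) s| ≤ M := by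
  have hcont : Continuous (deriv (deriv cutoff)) :=
    (contDiff_infty_iff_deriv.1 contDiff_deriv_cutoff).2.continuous
  obtain ⟨M, hM⟩ := (isCompact_Icc (a := (0 : ℝ)) (b := 2)).exists_bound_of_continuousOn
    hcont.continuousOn
  have hM0 : 0 ≤ M := (norm_nonneg _).trans (hM 0 (by simp))
  refine ⟨M, hM0, fun s hs => ?_⟩
  rcases le_or_gt s 2 with h | h
  · exact hM s ⟨hs, h⟩
  · simpa [deriv_deriv_cutoff_eq_zero h] using hM0

/-- The radial test function `χ(ρ |x|²)`. -/
def radialCutoff (ρ : ℝ) (x : E3) : ℝ := cutoff (ρ * ‖x‖ ^ 2)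

variable {ρ : ℝ}

theorem contDiff_radialCutoff : ContDiff ℝ ∞ (radialCutoff ρ) :=
  contDiff_cutoff.comp (contDiff_const.mul contDiff_norm_sq_E3)

theorem hasCompactSupport_radialCutoff (hρ : 0 < ρ) : HasCompactSupport (radialCutoff ρ) := by
  refine HasCompactSupport.intro (isCompact_closedBall (0 : E3) (2 / ρ + 1)) fun x hx => ?_
  have hx' : 2 / ρ + 1 < ‖x‖ := by simpa using hx
  have h2 : 0 < 2 / ρ := by positivity
  have h3 : 2 / ρ ≤ ‖x‖ ^ 2 := by nlinarith
  refine cutoff_eq_zero ?_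
  rwa [div_le_iff₀' hρ] at h3

theorem pd_radialCutoff (i : Fin 3) (x : E3) :
    pd i (radialCutoff ρ) x = deriv cutoff (ρ * ‖x‖ ^ 2) * (2 * ρ * x i) := by
  have hn := contDiff_differentiable contDiff_norm_sq_E3
  have h := pd_comp (contDiff_cutoff.differentiable (by simp)) (hn.const_mul ρ) i x
  rw [pd_const_mul hn, pd_norm_sq] at h
  rw [show radialCutoff ρ = fun y => cutoff (ρ * ‖y‖ ^ 2) from rfl, h]
  ring

theorem hess_radialCutoff (i j : Fin 3) (x : E3) :
    hess (radialCutoff ρ) i j x = 4 * ρ ^ 2 * deriv (deriv cutoff) (ρ * ‖x‖ ^ 2) * (x i * x j)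
      + 2 * ρ * deriv cutoff (ρ * ‖x‖ ^ 2) * (if i = j then 1 else 0) := by
  have hn := contDiff_differentiable contDiff_norm_sq_E3
  have hd : Differentiable ℝ (deriv cutoff) := contDiff_deriv_cutoff.differentiable (by simp)
  have hdc : Differentiable ℝ fun y : E3 => deriv cutoff (ρ * ‖y‖ ^ 2) :=
    hd.comp (hn.const_mul ρ)
  have h1 : pd i (radialCutoff ρ) = fun y => deriv cutoff (ρ * ‖y‖ ^ 2) * (2 * ρ * y i) :=
    funext fun y => pd_radialCutoff i y
  rw [hess, h1, pd_mul hdc ((differentiable_coord i).const_mul _),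
    pd_comp hd (hn.const_mul ρ), pd_const_mul hn, pd_norm_sq, pd_const_mul (differentiable_coord i),
    pd_coord]
  simp only [eq_comm]
  ring

end Cutoff

/-! ### Liouville theorem for the shifted `σ₂` equation -/

section Liouville

/-- `|x × ∇u|²`. -/
def crossSq (u : E3 → ℝ) (x : E3) : ℝ :=
  (x 0 * pd 1 u x - x 1 * pd 0 u x) ^ 2 + (x 0 * pd 2 u x - x 2 * pd 0 u x) ^ 2
    + (x 1 * pd 2 u x - x 2 * pd 1 u x) ^ 2

theorem crossSq_nonneg (u : E3 → ℝ) (x : E3) : 0 ≤ crossSq u x := by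
  unfold crossSq; positivity

variable {h : E3 → ℝ}

/-- For `φ = χ(ρ|x|²)` the negated integrand of `integral_sigma_two` is `4ρ²χ''|x × ∇h|² +
4ρχ'|∇h|²`, and the last term is dropped because `χ' ≤ 0`. The rest lives in the ball of radius
`2R`, so the bound is `4R⁻⁴ M (K + 2εR)` times `8R³` unit-ball volumes. -/
theorem neg_integral_sigma_two_le (hh : ContDiff ℝ ∞ h) {M K ε : ℝ} (hM : 0 ≤ M) (hε : 0 ≤ ε)
    (hMb : ∀ s, 0 ≤ s → |deriv (deriv cutoff) s| ≤ M)
    (hK : ∀ x, crossSq h x ≤ K + ε * ‖x‖) {R : ℝ} (hR : 0 < R) :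
    -∫ x, radialCutoff (1 / R ^ 2) x
        * ((∑ i, hess h i i x) ^ 2 - ∑ i, ∑ j, hess h i j x ^ 2)
      ≤ 32 * M * volume.real (Metric.ball (0 : E3) 1) * (K / R + 2 * ε) := by
  set ρ := 1 / R ^ 2 with hρd
  have hρ : 0 < ρ := by positivity
  have hφ := contDiff_radialCutoff (ρ := ρ)
  have hc := hasCompactSupport_radialCutoff hρ
  rw [integral_sigma_two hh hφ hc, ← integral_neg]
  have hK0 : 0 ≤ K := by simpa using (crossSq_nonneg h 0).trans (hK 0)
  set c : ℝ := 4 * ρ ^ 2 * M * (K + ε * (2 * R)) with hcdef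
  have hcpos : 0 ≤ c := by positivity
  have hfin : volume (Metric.ball (0 : E3) (2 * R)) ≠ ⊤ := measure_ball_lt_top.ne
  have hind : Integrable ((Metric.ball (0 : E3) (2 * R)).indicator fun _ => c) :=
    (integrable_indicator_iff measurableSet_ball).2 (integrableOn_const hfin)
  have hpt : ∀ x, -∑ i, ∑ j, (hess (radialCutoff ρ) i j x * (pd i h x * pd j h x)
        - hess (radialCutoff ρ) i i x * pd j h x ^ 2)
      ≤ (Metric.ball (0 : E3) (2 * R)).indicator (fun _ => c) x := by
    intro x
    have hn : ‖x‖ ^ 2 = x 0 ^ 2 + x 1 ^ 2 + x 2 ^ 2 := by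
      simp [EuclideanSpace.norm_sq_eq, Fin.sum_univ_three]
    have e : -∑ i, ∑ j, (hess (radialCutoff ρ) i j x * (pd i h x * pd j h x)
        - hess (radialCutoff ρ) i i x * pd j h x ^ 2)
        = 4 * ρ ^ 2 * deriv (deriv cutoff) (ρ * ‖x‖ ^ 2) * crossSq h x
          + 4 * ρ * deriv cutoff (ρ * ‖x‖ ^ 2)
            * (pd 0 h x ^ 2 + pd 1 h x ^ 2 + pd 2 h x ^ 2) := by
      simp only [hess_radialCutoff, Fin.sum_univ_three, crossSq]
      simp
      ring
    rw [e]
    have h1 : 4 * ρ * deriv cutoff (ρ * ‖x‖ ^ 2)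
        * (pd 0 h x ^ 2 + pd 1 h x ^ 2 + pd 2 h x ^ 2) ≤ 0 :=
      mul_nonpos_of_nonpos_of_nonneg
        (mul_nonpos_of_nonneg_of_nonpos (by positivity) (deriv_cutoff_nonpos _)) (by positivity)
    by_cases hx : x ∈ Metric.ball (0 : E3) (2 * R)
    · rw [Set.indicator_of_mem hx]
      have hx' : ‖x‖ ≤ 2 * R := by simpa using (Metric.mem_ball.1 hx).le
      have h2 : deriv (deriv cutoff) (ρ * ‖x‖ ^ 2) * crossSq h x
          ≤ M * (K + ε * (2 * R)) :=
        mul_le_mul ((le_abs_self _).trans (hMb _ (by positivity)))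
          ((hK x).trans (by gcongr)) (crossSq_nonneg h x) hM
      have h3 := mul_le_mul_of_nonneg_left h2 (by positivity : 0 ≤ 4 * ρ ^ 2)
      rw [hcdef]
      linarith
    · rw [Set.indicator_of_notMem hx]
      have hx' : 2 * R ≤ ‖x‖ := by simpa using hx
      have h2 : 2 < ρ * ‖x‖ ^ 2 := by
        rw [hρd, one_div_mul_eq_div, lt_div_iff₀ (by positivity)]
        nlinarith [sq_pos_of_pos hR]
      rw [deriv_deriv_cutoff_eq_zero h2]
      linarith
  have hi1 : Integrable fun x => -∑ i, ∑ j, (hess (radialCutoff ρ) i j x * (pd i h x * pd j h x)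
        - hess (radialCutoff ρ) i i x * pd j h x ^ 2) := by
    refine (integrable_finsetSum _ fun i _ => integrable_finsetSum _ fun j _ => ?_).neg
    have h2 := fun i => contDiff_pd hh i
    have h4 := fun i j => contDiff_hess hφ i j
    have hc' := fun i j => hasCompactSupport_pd (hasCompactSupport_pd hc i) j
    refine Continuous.integrable_of_hasCompactSupport ?_ ?_
    · exact ((h4 i j).mul ((h2 i).mul (h2 j))).continuous.sub
        ((h4 i i).mul ((h2 j).pow 2)).continuous
    · exact (HasCompactSupport.mul_right (hc' i j)).sub (HasCompactSupport.mul_right (hc' i i))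
  refine (integral_mono hi1 hind hpt).trans_eq ?_
  rw [integral_indicator_const _ measurableSet_ball, Measure.real,
    Measure.addHaar_ball _ _ (by positivity : 0 ≤ 2 * R)]
  simp only [ENNReal.toReal_mul, finrank_euclideanSpace, Fintype.card_fin, smul_eq_mul,
    Measure.real]
  rw [ENNReal.toReal_ofReal (by positivity), hcdef, hρd]
  field_simp
  ring

/-- A Liouville theorem: if `σ₂(D²h) = -k Δh` with `Δh ≥ 0` and `k > 0`, and
`|x × ∇h|²` grows slower than linearly, then `h` is harmonic. -/
theorem sum_hess_eq_zero_of_crossSq_le (hh : ContDiff ℝ ∞ h) {k : ℝ} (hk : 0 < k)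
    (hpos : ∀ x, 0 ≤ ∑ i, hess h i i x)
    (heq : ∀ x, (∑ i, hess h i i x) ^ 2 - ∑ i, ∑ j, hess h i j x ^ 2 = -k * ∑ i, hess h i i x)
    (hgrowth : ∀ ε > 0, ∃ K, ∀ x, crossSq h x ≤ K + ε * ‖x‖) (x : E3) :
    ∑ i, hess h i i x = 0 := by
  by_contra hx
  set L : E3 → ℝ := fun y => ∑ i, hess h i i y with hL
  have hLc : Continuous L := continuous_finsetSum _ fun i _ => (contDiff_hess hh i i).continuous
  set φ : ℝ → E3 → ℝ := fun R => radialCutoff (1 / R ^ 2) with hφ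
  have hφc : ∀ R, Continuous (φ R) := fun R => contDiff_radialCutoff.continuous
  have hφs : ∀ R, 0 < R → HasCompactSupport (φ R) := fun R hR =>
    hasCompactSupport_radialCutoff (by positivity)
  have hφ0 : ∀ R y, 0 ≤ φ R y := fun R y => cutoff_nonneg _
  have hφmono : ∀ R S y, 0 < R → R ≤ S → φ R y ≤ φ S y := fun R S y hR hRS =>
    antitone_cutoff (by gcongr)
  set R₀ : ℝ := ‖x‖ + 1 with hR₀
  have hR₀0 : 0 < R₀ := by positivity
  have hint : ∀ R, 0 < R → Integrable fun y => φ R y * L y := fun R hR =>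
    ((hφc R).mul hLc).integrable_of_hasCompactSupport (hφs R hR).mul_right
  have hI₀ : 0 < ∫ y, φ R₀ y * L y := by
    refine Continuous.integral_pos_of_hasCompactSupport_nonneg_nonzero ((hφc R₀).mul hLc)
      (hφs R₀ hR₀0).mul_right (fun y => mul_nonneg (hφ0 _ _) (hpos y)) (x := x) ?_
    have : φ R₀ x = 1 := by
      refine cutoff_eq_one ?_
      rw [one_div_mul_eq_div, div_le_one (by positivity)]
      gcongr
      linarith
    simpa [this] using hx
  set I₀ := ∫ y, φ R₀ y * L y with hI
  obtain ⟨M, hM, hMb⟩ := exists_deriv_deriv_cutoff_le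
  set B : ℝ := 32 * M * volume.real (Metric.ball (0 : E3) 1) with hB
  have hB0 : 0 ≤ B := by positivity
  -- Chosen so that `2Bε ≤ k I₀ / 2`; the `+ 1` covers `B = 0`.
  set ε : ℝ := k * I₀ / (4 * (B + 1)) with hε
  have hε0 : 0 < ε := by positivity
  obtain ⟨K, hK⟩ := hgrowth ε hε0
  -- Since the cutoffs increase with `R` and `L ≥ 0`, the fixed positive quantity `k I₀` stays below
  -- a bound that tends to `2Bε` as `R → ∞`.
  have key : ∀ R, R₀ ≤ R → k * I₀ ≤ B * (K / R + 2 * ε) := by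
    intro R hR
    have hR0 := hR₀0.trans_le hR
    refine le_trans ?_ (neg_integral_sigma_two_le hh hM hε0.le hMb hK hR0)
    have e : -∫ y, radialCutoff (1 / R ^ 2) y
        * ((∑ i, hess h i i y) ^ 2 - ∑ i, ∑ j, hess h i j y ^ 2) = k * ∫ y, φ R y * L y := by
      rw [← integral_neg, ← integral_const_mul]
      refine integral_congr_ae (Eventually.of_forall fun y => ?_)
      simp only [heq, hφ, hL]
      ring
    rw [e]
    refine mul_le_mul_of_nonneg_left ?_ hk.le
    exact integral_mono (hint _ hR₀0) (hint _ hR0) fun y =>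
      mul_le_mul_of_nonneg_right (hφmono _ _ y hR₀0 hR) (hpos y)
  have h2 : B * (2 * ε) ≤ k * I₀ / 2 := by
    rw [hε]
    have h3 : 0 < B + 1 := by positivity
    have h4 : 0 < k * I₀ := by positivity
    rw [show B * (2 * (k * I₀ / (4 * (B + 1)))) = (B / (B + 1)) * (k * I₀ / 2) by
      field_simp; ring]
    have : B / (B + 1) ≤ 1 := by rw [div_le_one h3]; linarith
    nlinarith
  have hkI : 0 < k * I₀ := by positivity
  have hlim : Tendsto (fun R : ℝ => B * K / R) atTop (𝓝 0) := tendsto_const_nhds.div_atTop tendsto_id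
  obtain ⟨R, hR1, hR2⟩ := ((hlim.eventually (gt_mem_nhds (half_pos hkI))).and
    (eventually_ge_atTop R₀)).exists
  have := key R hR2
  rw [mul_add, ← mul_div_assoc] at this
  linarith

end Liouville

/-! ### Smoothness and radiality of the spherical average -/

section SphericalAverage

/-- The weighted spherical integral `∫ c(σ) u(r σ) dσ` as a function of the radius. -/
def sphInt (c : Metric.sphere (0 : E3) 1 → ℝ) (u : E3 → ℝ) (r : ℝ) : ℝ :=
  ∫ σ : Metric.sphere (0 : E3) 1, c σ * u (r • (σ : E3)) ∂((volume : Measure E3).toSphere)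

/-- The weight `c` makes the class closed under differentiation: each derivative only multiplies it
by a coordinate of `σ`. Smoothness then follows by induction. -/
theorem hasDerivAt_sphInt {c : Metric.sphere (0 : E3) 1 → ℝ} (hc : Continuous c) {u : E3 → ℝ}
    (hu : ContDiff ℝ ∞ u) (r : ℝ) :
    HasDerivAt (sphInt c u) (∑ i, sphInt (fun σ => c σ * (σ : E3) i) (pd i u) r) r := by
  have hpd := fun i => (contDiff_pd hu i).continuous
  set F' : ℝ → Metric.sphere (0 : E3) 1 → ℝ :=
    fun s σ => c σ * ∑ i, (σ : E3) i * pd i u (s • (σ : E3)) with hF'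
  have hF'c : Continuous fun p : ℝ × Metric.sphere (0 : E3) 1 => F' p.1 p.2 := by
    have hu' := hu.continuous
    simp only [hF']
    fun_prop
  obtain ⟨M, hM⟩ := ((isCompact_closedBall r 1).prod
    (isCompact_univ (X := Metric.sphere (0 : E3) 1))).exists_bound_of_continuousOn
      hF'c.continuousOn
  have hint : ∀ v : Metric.sphere (0 : E3) 1 → ℝ, Continuous v →
      Integrable v (volume : Measure E3).toSphere := fun v hv =>
    hv.integrable_of_hasCompactSupport (HasCompactSupport.of_compactSpace v)
  have hF : ∀ s : ℝ, Continuous fun σ : Metric.sphere (0 : E3) 1 => c σ * u (s • (σ : E3)) := by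
    intro s
    have hu' := hu.continuous
    fun_prop
  have key := (hasDerivAt_integral_of_dominated_loc_of_deriv_le
    (μ := (volume : Measure E3).toSphere)
    (F := fun (s : ℝ) (σ : Metric.sphere (0 : E3) 1) => c σ * u (s • (σ : E3)))
    (F' := F') (bound := fun _ => M) (Metric.closedBall_mem_nhds r one_pos)
    (Eventually.of_forall fun s => (hF s).aestronglyMeasurable) (hint _ (hF r))
    (hF'c.comp (Continuous.prodMk_right r)).aestronglyMeasurable
    (Eventually.of_forall fun σ s hs => hM (s, σ) ⟨hs, Set.mem_univ _⟩)
    (integrable_const M)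
    (Eventually.of_forall fun σ s _ => by
      simpa using (deriv_line (contDiff_differentiable hu) 0 (σ : E3) s).const_mul (c σ))).2
  have hsum : ∑ i, sphInt (fun σ => c σ * (σ : E3) i) (pd i u) r
      = ∫ σ, F' r σ ∂(volume : Measure E3).toSphere := by
    simp only [sphInt, hF', Finset.mul_sum]
    rw [integral_finsetSum]
    · simp only [mul_assoc]
    · intro i _
      refine hint _ ?_
      have := hpd i
      fun_prop
  rw [hsum]
  exact key

theorem contDiff_sphInt (n : ℕ) {c : Metric.sphere (0 : E3) 1 → ℝ} (hc : Continuous c)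
    {u : E3 → ℝ} (hu : ContDiff ℝ ∞ u) : ContDiff ℝ n (sphInt c u) := by
  induction n generalizing c u with
  | zero =>
    exact contDiff_zero.2 (continuous_iff_continuousAt.2 fun r =>
      (hasDerivAt_sphInt hc hu r).continuousAt)
  | succ n ih =>
    push_cast
    refine contDiff_succ_iff_deriv.2 ⟨fun r => (hasDerivAt_sphInt hc hu r).differentiableAt,
      by simp, ?_⟩
    rw [funext fun r => (hasDerivAt_sphInt hc hu r).deriv]
    exact ContDiff.sum fun i _ => ih (by fun_prop) (contDiff_pd hu i)

/-- The profile `F` makes sense for all real radii, so it is differentiated on the line with no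
endpoint at `0`. -/
theorem exists_sphAvg_eq {f : E3 → ℝ} (hf : ContDiff ℝ ∞ f) :
    ∃ F : ℝ → ℝ, ContDiff ℝ 2 F ∧ sphAvg f = fun x => F ‖x‖ := by
  refine ⟨fun r => ((volume : Measure E3).toSphere.real Set.univ)⁻¹ * sphInt (fun _ => 1) f r,
    contDiff_const.mul (contDiff_sphInt 2 continuous_const hf), ?_⟩
  ext x
  simp [sphAvg, sphInt, average_eq]

theorem contDiffAt_sub_sphAvg {f : E3 → ℝ} (hf : ContDiff ℝ ∞ f) {x : E3} (hx : x ≠ 0) :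
    ContDiffAt ℝ 2 (f - sphAvg f) x := by
  obtain ⟨F, hF, h⟩ := exists_sphAvg_eq hf
  rw [h]
  exact (hf.of_le two_le_infty).contDiffAt.sub (hF.contDiffAt.comp x (contDiffAt_norm ℝ hx))

/-- The gradient of a radial function is a multiple of `x`, so it drops out of `x × ∇`. -/
theorem crossSq_sub_sphAvg {f : E3 → ℝ} (hf : ContDiff ℝ ∞ f) {x : E3} (hx : x ≠ 0) :
    crossSq (f - sphAvg f) x = crossSq f x := by
  obtain ⟨F, hF, h⟩ := exists_sphAvg_eq hf
  obtain ⟨t, ht⟩ : ∃ t : ℝ, ∀ i, pd i (sphAvg f) x = t * x i := by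
    have hF' : DifferentiableAt ℝ F ‖x‖ := hF.differentiable (by simp) _
    have hn : DifferentiableAt ℝ (fun y : E3 => ‖y‖) x :=
      (contDiffAt_norm ℝ hx (n := 1)).differentiableAt (by simp)
    have hc : HasFDerivAt (sphAvg f) (deriv F ‖x‖ • fderiv ℝ (fun y : E3 => ‖y‖) x) x := by
      rw [h]
      exact hF'.hasDerivAt.comp_hasFDerivAt x hn.hasFDerivAt
    refine ⟨deriv F ‖x‖ / ‖x‖, fun i => ?_⟩
    have hsq := pd_norm_sq i x
    have hsq' : pd i (fun y => ‖y‖ ^ 2) x = 2 * ‖x‖ * pd i (fun y => ‖y‖) x := by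
      simp [pd, fderiv_fun_pow 2 hn]
    have hx0 : ‖x‖ ≠ 0 := norm_ne_zero_iff.2 hx
    have hp : pd i (fun y => ‖y‖) x = x i / ‖x‖ := by
      rw [eq_div_iff hx0]; linarith
    rw [pd, hc.fderiv]
    simp only [_root_.smul_apply, smul_eq_mul]
    rw [show fderiv ℝ (fun y : E3 => ‖y‖) x (EuclideanSpace.single i 1) = x i / ‖x‖ from hp]
    ring
  have hs : DifferentiableAt ℝ (sphAvg f) x := by
    have := (contDiff_differentiable hf x).sub
      ((contDiffAt_sub_sphAvg hf hx).differentiableAt (by simp))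
    simpa using this
  have hd : ∀ i, pd i (f - sphAvg f) x = pd i f x - t * x i := by
    intro i
    rw [← ht, pd, fderiv_sub (contDiff_differentiable hf x) hs]
    rfl
  simp only [crossSq, hd]
  ring

end SphericalAverage

/-! ### Gradient decay from approximate spherical symmetry -/

section GradientDecay

variable {g : E3 → ℝ}

theorem inner_gradient (g : E3 → ℝ) (x w : E3) : inner ℝ (gradient g x) w = fderiv ℝ g x w := by
  simp [gradient]

/-- By symmetry of the Hessian, `∇|∇g|² = 2 ∇²g ∇g`. This turns the hypothesis on `∇²g ∇g` into a
Lipschitz bound for `|∇g|²`. -/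
theorem norm_fderiv_norm_gradient_sq_le {x : E3} (hg : ContDiffAt ℝ 2 g x) :
    DifferentiableAt ℝ (fun y => ‖gradient g y‖ ^ 2) x ∧
    ‖fderiv ℝ (fun y => ‖gradient g y‖ ^ 2) x‖
      ≤ 2 * ‖fderiv ℝ (gradient g) x (gradient g x)‖ := by
  have h1 : DifferentiableAt ℝ (fderiv ℝ g) x :=
    (hg.fderiv_right (m := 1) (by norm_num)).differentiableAt (by simp)
  set T : StrongDual ℝ E3 →L[ℝ] E3 := LinearMap.toContinuousLinearMap
    { toFun := (InnerProductSpace.toDual ℝ E3).symm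
      map_add' := map_add _
      map_smul' := fun a l => by simp } with hT
  have h2 : HasFDerivAt (gradient g) (T.comp (fderiv ℝ (fderiv ℝ g) x)) x :=
    T.hasFDerivAt.comp x h1.hasFDerivAt
  have happ : ∀ v w, inner ℝ (fderiv ℝ (gradient g) x v) w = fderiv ℝ (fderiv ℝ g) x v w := by
    intro v w
    rw [h2.fderiv]
    simp [hT]
  have h3 := h2.differentiableAt.hasFDerivAt.norm_sq
  refine ⟨h3.differentiableAt, ?_⟩
  rw [h3.fderiv]
  refine ContinuousLinearMap.opNorm_le_bound _ (by positivity) fun w => ?_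
  have hsymm := hg.isSymmSndFDerivAt (by simp) w (gradient g x)
  have e : inner ℝ (gradient g x) (fderiv ℝ (gradient g) x w)
      = inner ℝ (fderiv ℝ (gradient g) x (gradient g x)) w := by
    rw [real_inner_comm, happ, hsymm, happ]
  simp only [_root_.smul_apply, ContinuousLinearMap.comp_apply, innerSL_apply_apply,
    e, nsmul_eq_mul, Nat.cast_ofNat]
  rw [norm_mul, Real.norm_ofNat, mul_assoc]
  gcongr
  exact norm_inner_le_norm _ _

/-- A bounded function has a point of small gradient in every ball. -/
theorem exists_norm_gradient_le {x : E3} {s C : ℝ} (hs : 0 < s) (hC : 0 < C)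
    (hg : ∀ y ∈ Metric.closedBall x s, DifferentiableAt ℝ g y)
    (hb : ∀ y, |g y| ≤ C) : ∃ z ∈ Metric.closedBall x s, ‖gradient g z‖ ≤ 8 * C / s := by
  -- The penalty is `4C` on the boundary, more than the oscillation `2C` of `g`, so the maximum is
  -- interior; there `∇g = 2K(z - x)`, of norm at most `2Ks = 8C/s`.
  set K : ℝ := 4 * C / s ^ 2 with hK
  have hK0 : 0 < K := by positivity
  obtain ⟨z, hz, hmax⟩ := (isCompact_closedBall x s).exists_isMaxOn
    ⟨x, Metric.mem_closedBall_self hs.le⟩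
    (f := fun y => g y - K * ‖y - x‖ ^ 2)
    (fun y hy => ((hg y hy).continuousAt.sub (by fun_prop)).continuousWithinAt)
  refine ⟨z, hz, ?_⟩
  have hxz : g x - K * ‖x - x‖ ^ 2 ≤ g z - K * ‖z - x‖ ^ 2 :=
    hmax (Metric.mem_closedBall_self hs.le)
  have hzs : ‖z - x‖ ≤ s := by simpa [dist_eq_norm] using hz
  have hin : ‖z - x‖ < s := by
    by_contra! hge
    rw [le_antisymm hzs hge, hK] at hxz
    have h1 := abs_le.1 (hb x)
    have h2 := abs_le.1 (hb z)
    have h3 : 4 * C / s ^ 2 * s ^ 2 = 4 * C := by field_simp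
    simp at hxz
    linarith
  have hloc : IsLocalMax (fun y => g y - K * ‖y - x‖ ^ 2) z := hmax.isLocalMax (by
    rw [mem_nhds_iff]
    exact ⟨Metric.ball x s, Metric.ball_subset_closedBall, Metric.isOpen_ball,
      by simpa [dist_eq_norm] using hin⟩)
  have hq := (((hasFDerivAt_id z).sub_const x).norm_sq).const_mul K
  have h0 := hloc.hasFDerivAt_eq_zero ((hg z hz).hasFDerivAt.sub hq)
  have h1 := sub_eq_zero.1 h0
  have hn : ‖gradient g z‖ = ‖fderiv ℝ g z‖ := by simp [gradient]
  rw [hn, h1]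
  refine ContinuousLinearMap.opNorm_le_bound _ (by positivity) fun w => ?_
  simp only [_root_.smul_apply, ContinuousLinearMap.comp_apply, innerSL_apply_apply,
    nsmul_eq_mul, Nat.cast_ofNat, smul_eq_mul, id, ContinuousLinearMap.id_apply]
  rw [norm_mul, norm_mul, Real.norm_ofNat, Real.norm_of_nonneg hK0.le]
  calc K * (2 * ‖inner ℝ (z - x) w‖) ≤ K * (2 * (s * ‖w‖)) := by
        gcongr
        exact (norm_inner_le_norm _ _).trans (by gcongr)
    _ = 8 * C / s * ‖w‖ := by rw [hK]; field_simp; ring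

/-- In the ball of radius `r/2` about `x` some point has `|∇g| ≤ 16C/r`, and `|∇g|²` has derivative
at most `2ε/(r/2)²`. Integrating over a distance `r/2` adds at most `4ε/r`. -/
theorem norm_gradient_sq_le {C ε r₀ : ℝ} (hr₀ : 0 < r₀) (hC : 0 < C)
    (hg : ∀ y, y ≠ 0 → ContDiffAt ℝ 2 g y) (hb : ∀ y, |g y| ≤ C) (hε : 0 ≤ ε)
    (hd : ∀ y, r₀ ≤ ‖y‖ → ‖y‖ ^ 2 * ‖fderiv ℝ (gradient g) y (gradient g y)‖ ≤ ε)
    {x : E3} (hx : 2 * r₀ ≤ ‖x‖) :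
    ‖gradient g x‖ ^ 2 ≤ 256 * C ^ 2 / ‖x‖ ^ 2 + 4 * ε / ‖x‖ := by
  set r := ‖x‖ with hr
  have hr0 : 0 < r := by linarith
  have hy : ∀ y ∈ Metric.closedBall x (r / 2), r / 2 ≤ ‖y‖ := by
    intro y hy
    have h1 : ‖x - y‖ ≤ r / 2 := by simpa [dist_eq_norm, norm_sub_rev] using hy
    have := norm_sub_norm_le x y
    linarith
  have hy0 : ∀ y ∈ Metric.closedBall x (r / 2), y ≠ 0 := fun y h =>
    norm_pos_iff.1 ((half_pos hr0).trans_le (hy y h))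
  obtain ⟨z, hz, hzg⟩ := exists_norm_gradient_le (half_pos hr0) hC
    (fun y h => (hg y (hy0 y h)).differentiableAt (by simp)) hb
  have hmv := (convex_closedBall x (r / 2)).norm_image_sub_le_of_norm_fderiv_le (𝕜 := ℝ)
    (f := fun y => ‖gradient g y‖ ^ 2) (C := 8 * ε / r ^ 2)
    (fun y h => (norm_fderiv_norm_gradient_sq_le (hg y (hy0 y h))).1)
    (fun y h => by
      refine (norm_fderiv_norm_gradient_sq_le (hg y (hy0 y h))).2.trans ?_
      have h1 := hy y h
      have h2 := hd y (by linarith)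
      rw [le_div_iff₀ (by positivity)]
      have h3 : (r / 2) ^ 2 * ‖fderiv ℝ (gradient g) y (gradient g y)‖ ≤ ε :=
        le_trans (by gcongr) h2
      linarith)
    hz (Metric.mem_closedBall_self (half_pos hr0).le)
  have h1 : ‖x - z‖ ≤ r / 2 := by simpa [dist_eq_norm, norm_sub_rev] using hz
  have h2 : 8 * ε / r ^ 2 * ‖x - z‖ ≤ 4 * ε / r := by
    calc 8 * ε / r ^ 2 * ‖x - z‖ ≤ 8 * ε / r ^ 2 * (r / 2) := by gcongr
      _ = 4 * ε / r := by field_simp; ring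
  have h3 : ‖gradient g z‖ ^ 2 ≤ 256 * C ^ 2 / r ^ 2 := by
    calc ‖gradient g z‖ ^ 2 ≤ (8 * C / (r / 2)) ^ 2 := by gcongr
      _ = 256 * C ^ 2 / r ^ 2 := by field_simp; ring
  have h4 := (le_abs_self _).trans hmv
  linarith

theorem gradient_apply (g : E3 → ℝ) (x : E3) (i : Fin 3) : gradient g x i = pd i g x := by
  rw [pd, ← inner_gradient, EuclideanSpace.inner_single_right]
  simp only [one_mul, conj_trivial]

/-- Lagrange's identity, dropping `(x · ∇g)²`. -/
theorem crossSq_le (g : E3 → ℝ) (x : E3) : crossSq g x ≤ ‖x‖ ^ 2 * ‖gradient g x‖ ^ 2 := by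
  have h1 : ∀ y : E3, ‖y‖ ^ 2 = y 0 ^ 2 + y 1 ^ 2 + y 2 ^ 2 := fun y => by
    simp [EuclideanSpace.norm_sq_eq, Fin.sum_univ_three]
  rw [h1, h1, gradient_apply, gradient_apply, gradient_apply, crossSq]
  nlinarith [sq_nonneg (x 0 * pd 0 g x + x 1 * pd 1 g x + x 2 * pd 2 g x)]

theorem ApproxSphericallySymmetric.crossSq_le {f : E3 → ℝ} (hf : ContDiff ℝ ∞ f)
    (h : ApproxSphericallySymmetric f) {ε : ℝ} (hε : 0 < ε) :
    ∃ K, ∀ x, crossSq f x ≤ K + ε * ‖x‖ := by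
  obtain ⟨⟨C, hC⟩, hlim⟩ := h
  obtain ⟨r₁, hr₁⟩ := hlim (ε / 4) (by positivity)
  set r₀ := max r₁ 1 with hr₀
  have hr₀0 : 0 < r₀ := lt_max_of_lt_right one_pos
  have hC0 : 0 ≤ C := (abs_nonneg _).trans (hC 0)
  have hcont : Continuous (crossSq f) := by
    have := fun i => (contDiff_pd hf i).continuous
    unfold crossSq
    fun_prop
  obtain ⟨K, hK⟩ := (isCompact_closedBall (0 : E3) (2 * r₀)).exists_bound_of_continuousOn
    hcont.continuousOn
  refine ⟨max K (256 * (C + 1) ^ 2), fun x => ?_⟩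
  rcases le_or_gt ‖x‖ (2 * r₀) with hx | hx
  · have h1 := (le_abs_self _).trans (hK x (by simpa using hx))
    have h2 : 0 ≤ ε * ‖x‖ := by positivity
    linarith [le_max_left K (256 * (C + 1) ^ 2)]
  · have hx0 : 0 < ‖x‖ := by linarith
    have h1 := norm_gradient_sq_le (g := f - sphAvg f) (C := C + 1) (ε := ε / 4) hr₀0
      (by linarith) (fun y hy => contDiffAt_sub_sphAvg hf hy)
      (fun y => (hC y).trans (by linarith)) (by positivity)
      (fun y hy => hr₁ ‖y‖ ((le_max_left _ _).trans hy) y (by simp)) hx.le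
    rw [← crossSq_sub_sphAvg hf (norm_pos_iff.1 hx0)]
    calc crossSq (f - sphAvg f) x ≤ ‖x‖ ^ 2 * ‖gradient (f - sphAvg f) x‖ ^ 2 := FFR.crossSq_le _ _
      _ ≤ ‖x‖ ^ 2 * (256 * (C + 1) ^ 2 / ‖x‖ ^ 2 + 4 * (ε / 4) / ‖x‖) := by gcongr
      _ = 256 * (C + 1) ^ 2 + ε * ‖x‖ := by field_simp
      _ ≤ _ := by gcongr; exact le_max_right _ _

end GradientDecay

/-! ### Uniqueness -/

section Uniqueness

variable {Λ : ℝ} {f : E3 → ℝ} {ζ : E3 → E3} {η : E3 → ℝ}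

theorem IsAdmissibleVacuum.lap_pos (h : IsAdmissibleVacuum Λ f ζ η) (x : E3) : 0 < lap f x :=
  (div_pos_iff_of_pos_right (h.solution.eta_pos x)).1 (h.arrow x)

/-- The first equation with `Λ > 0` is exactly what gives the ellipticity bound `|Q|² ≤ (Δf)²`. -/
theorem IsAdmissibleVacuum.eta_eq_one (hΛ : 0 < Λ) (h : IsAdmissibleVacuum Λ f ζ η) (x : E3) :
    η x = 1 := by
  refine eq_of_elliptic_of_tendsto h.solution.smooth_eta (T := lap f) (q := Q f ζ) h.lap_pos
    (fun y => ?_) (fun y => ?_) h.eta_lim x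
  · have h1 := h.solution.eq_f y
    have h2 : 0 < 2 * Λ * η y ^ 2 := by
      have := h.solution.eta_pos y
      positivity
    simp only [Pi.zero_apply, mul_zero, zero_add] at h1
    linarith
  · have h1 := h.solution.eq_eta y
    simpa [divergence, coeff] using h1

theorem contDiff_component (hζ : ContDiff ℝ ∞ ζ) (i : Fin 3) : ContDiff ℝ ∞ fun y => ζ y i :=
  (EuclideanSpace.proj (𝕜 := ℝ) i : E3 →L[ℝ] ℝ).contDiff.comp hζ

theorem IsAdmissibleVacuum.zeta_eq_zero (hΛ : 0 < Λ) (h : IsAdmissibleVacuum Λ f ζ η) (x : E3) :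
    ζ x = 0 := by
  have hη : η = fun _ => 1 := funext (h.eta_eq_one hΛ)
  ext i
  have hs := contDiff_component h.solution.smooth_zeta i
  -- With `T = 1` and `q = 0` the operator is the Laplacian.
  refine eq_of_elliptic_of_tendsto hs (T := fun _ => 1) (q := fun _ _ _ => 0)
    (fun _ => one_pos) (by simp) (fun y => ?_) ?_ x
  · have h1 := h.solution.eq_zeta y i
    rw [lap_eq_sum_hess hs] at h1
    simpa [hη] using h1
  · have h1 := ((EuclideanSpace.proj (𝕜 := ℝ) i : E3 →L[ℝ] ℝ).continuous.tendsto 0).comp h.zeta_lim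
    simpa [Function.comp_def] using h1

theorem IsAdmissibleVacuum.sigma_two_eq (hΛ : 0 < Λ) (h : IsAdmissibleVacuum Λ f ζ η) (x : E3) :
    (∑ i, hess f i i x) ^ 2 - ∑ i, ∑ j, hess f i j x ^ 2 = 2 * Λ := by
  have hη : η = fun _ => 1 := funext (h.eta_eq_one hΛ)
  have hζ : ζ = fun _ => 0 := funext (h.zeta_eq_zero hΛ)
  have h1 := h.solution.eq_f x
  rw [lap_eq_sum_hess h.solution.smooth_f] at h1
  simpa [hη, hζ, Q] using h1

theorem eq_affine_of_hess_eq_zero {h : E3 → ℝ} (hh : ContDiff ℝ ∞ h)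
    (h0 : ∀ i j x, hess h i j x = 0) :
    ∃ b : Fin 3 → ℝ, ∀ x, h x = h 0 + ∑ i, x i * b i := by
  have hpd : ∀ i x, pd i h x = pd i h 0 := by
    intro i x
    refine is_const_of_fderiv_eq_zero (𝕜 := ℝ) (contDiff_differentiable (contDiff_pd hh i))
      (fun y => ?_) x 0
    ext ξ
    rw [fderiv_apply_eq_sum_pd]
    exact Finset.sum_eq_zero fun j _ => by rw [← hess, h0, mul_zero]
  refine ⟨fun i => pd i h 0, fun x => ?_⟩
  have hd : ∀ t : ℝ, HasDerivAt (fun s : ℝ => h (0 + s • x) - s * ∑ i, x i * pd i h 0) 0 t := by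
    intro t
    have h1 := (deriv_line (contDiff_differentiable hh) 0 x t).sub
      ((hasDerivAt_id t).mul_const (∑ i, x i * pd i h 0))
    simp only [hpd _ (0 + t • x), one_mul, sub_self] at h1
    exact h1
  have h2 := is_const_of_deriv_eq_zero (fun t => (hd t).differentiableAt) (fun t => (hd t).deriv)
    1 0
  simp only [one_smul, zero_smul, zero_add, one_mul, zero_mul, sub_zero] at h2
  linarith

theorem crossSq_add_const_mul_norm_sq (hf : Differentiable ℝ f) (ε : ℝ) (x : E3) :
    crossSq (fun y => f y + ε * ‖y‖ ^ 2) x = crossSq f x := by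
  simp only [crossSq, pd_add_const_mul_norm_sq hf]
  ring

theorem IsAdmissibleVacuum.exists_eq {a : ℝ} (ha : 0 < a)
    (h : IsAdmissibleVacuum (12 * a ^ 2) f ζ η) : ∃ c : ℝ, ∀ x, f x = a * ‖x‖ ^ 2 + c := by
  have hf := h.solution.smooth_f
  have hσ := h.sigma_two_eq (by positivity)
  set u : E3 → ℝ := fun y => f y + -a * ‖y‖ ^ 2 with hu
  have hus : ContDiff ℝ ∞ u := hf.add (contDiff_const.mul contDiff_norm_sq_E3)
  have hhess : ∀ i j x, hess u i j x = hess f i j x + -a * if i = j then 2 else 0 :=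
    fun i j x => hess_add_const_mul_norm_sq hf (-a) i j x
  have heq : ∀ x, (∑ i, hess u i i x) ^ 2 - ∑ i, ∑ j, hess u i j x ^ 2
      = -(8 * a) * ∑ i, hess u i i x := by
    intro x
    have h1 := hσ x
    simp only [hhess, Fin.sum_univ_three] at h1 ⊢
    simp
    linear_combination h1
  have hpos : ∀ x, 0 ≤ ∑ i, hess u i i x := by
    intro x
    have h1 := hσ x
    have h2 : 0 < ∑ i, hess f i i x := by
      rw [← lap_eq_sum_hess hf]; exact h.lap_pos x
    -- From `|D²f|² ≥ (Δf)²/3` and `(Δf)² - |D²f|² = 24a²`; the arrow of time selects the positive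
    -- root.
    have h3 : 6 * a ≤ ∑ i, hess f i i x := by
      refine le_of_sq_le_sq ?_ h2.le
      simp only [Fin.sum_univ_three] at h1 ⊢
      nlinarith [sq_nonneg (hess f 0 0 x - hess f 1 1 x), sq_nonneg (hess f 0 0 x - hess f 2 2 x),
        sq_nonneg (hess f 1 1 x - hess f 2 2 x), sq_nonneg (hess f 0 1 x),
        sq_nonneg (hess f 0 2 x), sq_nonneg (hess f 1 0 x), sq_nonneg (hess f 1 2 x),
        sq_nonneg (hess f 2 0 x), sq_nonneg (hess f 2 1 x)]
    simp only [hhess, Fin.sum_univ_three] at h3 ⊢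
    simp
    linarith
  have hL : ∀ x, ∑ i, hess u i i x = 0 :=
    sum_hess_eq_zero_of_crossSq_le hus (by positivity : 0 < 8 * a) hpos heq fun ε hε => by
      obtain ⟨K, hK⟩ := h.approx_symm.crossSq_le hf hε
      refine ⟨K, fun x => ?_⟩
      rw [hu, crossSq_add_const_mul_norm_sq (contDiff_differentiable hf)]
      exact hK x
  have hH : ∀ i j x, hess u i j x = 0 := by
    intro i j x
    have h1 := heq x
    rw [hL x] at h1
    have h2 : ∑ i, ∑ j, hess u i j x ^ 2 = 0 := by linarith
    have h3 := (Finset.sum_eq_zero_iff_of_nonneg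
      fun i _ => Finset.sum_nonneg fun j _ => sq_nonneg (hess u i j x)).1 h2 i (Finset.mem_univ i)
    have h4 := (Finset.sum_eq_zero_iff_of_nonneg
      fun j _ => sq_nonneg (hess u i j x)).1 h3 j (Finset.mem_univ j)
    exact pow_eq_zero_iff two_ne_zero |>.1 h4
  obtain ⟨b, hb⟩ := eq_affine_of_hess_eq_zero hus hH
  obtain ⟨C, hC⟩ := h.approx_symm.1
  -- The average and the quadratic part are even, so comparing `f - f̄` at `x` and `-x` isolates the
  -- linear part.
  have hodd : ∀ x : E3, |∑ i, x i * b i| ≤ C := by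
    intro x
    have h1 := abs_le.1 (hC x)
    have h2 := abs_le.1 (hC (-x))
    have h3 : sphAvg f (-x) = sphAvg f x := by simp [sphAvg]
    have h4 := hb x
    have h5 := hb (-x)
    rw [h3] at h2
    simp only [hu, norm_neg, PiLp.neg_apply, neg_mul, Finset.sum_neg_distrib] at h4 h5
    rw [abs_le]
    constructor <;> linarith
  have hb0 : ∀ i, b i = 0 := by
    intro i
    by_contra hne
    have h1 := hodd (EuclideanSpace.single i ((C + 1) / b i))
    simp [hne] at h1
    linarith [le_abs_self (C + 1)]
  refine ⟨f 0, fun x => ?_⟩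
  have h1 := hb x
  simp [hu, hb0] at h1
  linarith

end Uniqueness

/-! ### Existence: the quadratic solution -/

section Existence

theorem sphAvg_radial (F : ℝ → ℝ) : sphAvg (fun x => F ‖x‖) = fun x => F ‖x‖ := by
  ext x
  have h : ∀ σ : Metric.sphere (0 : E3) 1, F ‖‖x‖ • (σ : E3)‖ = F ‖x‖ := fun σ => by
    rw [norm_smul, norm_norm, norm_eq_of_mem_sphere, mul_one]
  have : NeZero (volume : Measure E3).toSphere := ⟨Measure.toSphere_ne_zero _⟩
  simp only [sphAvg, h]
  exact average_const _ _

theorem approxSphericallySymmetric_radial (F : ℝ → ℝ) :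
    ApproxSphericallySymmetric (fun x => F ‖x‖) := by
  refine ⟨⟨0, fun x => by simp [sphAvg_radial]⟩, fun ε hε => ⟨0, fun r _ x _ => ?_⟩⟩
  have : gradient (0 : E3 → ℝ) = 0 := by
    ext1 y
    simp [gradient]
  rw [sphAvg_radial, sub_self, this]
  simpa using hε.le

theorem isAdmissibleVacuum_quadratic {a : ℝ} (ha : 0 < a) (c : ℝ) :
    IsAdmissibleVacuum (12 * a ^ 2) (fun x => a * ‖x‖ ^ 2 + c) (fun _ => 0) (fun _ => 1) := by
  have hf : ContDiff ℝ ∞ fun x : E3 => a * ‖x‖ ^ 2 + c :=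
    (contDiff_const.mul contDiff_norm_sq_E3).add contDiff_const
  have hc : ∀ i : Fin 3, pd i (fun _ : E3 => c) = fun _ => 0 := fun i => funext (pd_const c i)
  have h0 : ∀ i : Fin 3, pd i (fun _ : E3 => (0 : ℝ)) = fun _ => 0 :=
    fun i => funext (pd_const 0 i)
  have h1 : ∀ i : Fin 3, pd i (fun _ : E3 => (1 : ℝ)) = fun _ => 0 :=
    fun i => funext (pd_const 1 i)
  have hh : ∀ i j x, hess (fun x : E3 => a * ‖x‖ ^ 2 + c) i j x = a * if i = j then 2 else 0 := by
    intro i j x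
    have := hess_add_const_mul_norm_sq (u := fun _ => c) contDiff_const a i j x
    simp only [add_comm c] at this
    rw [this]
    simp [hess, hc]
  have hl : ∀ x, lap (fun x : E3 => a * ‖x‖ ^ 2 + c) x = 6 * a := by
    intro x
    rw [lap_eq_sum_hess hf]
    simp [hh]
    ring
  refine ⟨⟨hf, contDiff_const, contDiff_const, fun _ => one_pos, fun x => ?_, fun x i => ?_,
    fun x => ?_⟩, fun x => ?_, approxSphericallySymmetric_radial fun r => a * r ^ 2 + c,
    tendsto_const_nhds, tendsto_const_nhds⟩
  · simp [hl, Q, hh]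
    ring
  · rw [lap_eq_sum_hess (by simpa using contDiff_const)]
    simp [hess, h0]
  · simp [hess, h1, divergence]
  · rw [hl]; positivity

end Existence

end FFR

end

theorem mainTheorem1 (Λ : ℝ) (hΛ : 0 < Λ) :
    -- existence, including the normalization of the divergence at infinity
    (∀ c : ℝ,
      FFR.IsAdmissibleVacuum Λ (fun x => Real.sqrt (Λ / 12) * ‖x‖ ^ 2 + c)
          (fun _ => 0) (fun _ => 1) ∧
        Tendsto (FFR.divergence (fun _ => 0)) (cocompact FFR.E3) (𝓝 0)) ∧
    -- uniqueness, which needs no normalization of the divergence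
    (∀ (f : FFR.E3 → ℝ) (ζ : FFR.E3 → FFR.E3) (η : FFR.E3 → ℝ),
      FFR.IsAdmissibleVacuum Λ f ζ η →
        (∀ x, η x = 1) ∧ (∀ x, ζ x = 0) ∧
          ∃ c : ℝ, ∀ x, f x = Real.sqrt (Λ / 12) * ‖x‖ ^ 2 + c) := by
  -- Parametrizing by `a = √(Λ/12)` keeps the algebra polynomial.
  obtain ⟨a, ha, haΛ⟩ : ∃ a : ℝ, 0 < a ∧ Λ = 12 * a ^ 2 :=
    ⟨√(Λ / 12), by positivity, by rw [Real.sq_sqrt (by positivity)]; ring⟩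
  subst haΛ
  have hsqrt : √(12 * a ^ 2 / 12) = a := by
    rw [mul_div_cancel_left₀ _ (by norm_num : (12 : ℝ) ≠ 0), Real.sqrt_sq ha.le]
  rw [hsqrt]
  refine ⟨fun c => ⟨FFR.isAdmissibleVacuum_quadratic ha c, ?_⟩, fun f ζ η h =>
    ⟨h.eta_eq_one hΛ, h.zeta_eq_zero hΛ, h.exists_eq ha⟩⟩
  have : FFR.divergence (fun _ => 0) = fun _ => 0 := by
    ext x
    simp [FFR.divergence]
  rw [this]
  exact tendsto_const_nhds
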